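/- Let $V$ be a set of variables and $A$ a set of actions. A signature $\Sigma$ is a set of function symbols $f\notin V$, each with a finite arity $ar(f)$ ($\Sigma_1\subseteq\Sigma_2$ includes that the arities agree). Terms over $\Sigma$ are built from $V$ and $\Sigma$; a syntactic object is closed if no variable occurs in it. A $\Sigma$-literal is an expression $t\xrightarrow{a}t'$ (positive) or $t\not\xrightarrow{a}$ (negative) with $t,t'$ terms over $\Sigma$ and $a\in A$; $t$ is its left-hand side, $t'$ its right-hand side, and $t\xrightarrow{a}t'$ and $t\not\xrightarrow{a}$ deny each other. A transition rule $\frac{H}{\alpha}$ over $\Sigma$ has a set $H$ of $\Sigma$-literals (the premises) and a $\Sigma$-literal $\alpha$ (the conclusion); its source is the left-hand side of $\alpha$. A transition system specification (TSS) $P=(\Sigma,R)$ consists of a signature $\Sigma$ and a set $R$ of transition rules over $\Sigma$; it is standard if all its rules have positive conclusions. A rule is an ntyft rule if the right-hand sides of its positive premises are variables that are all distinct and do not occur in the source, and its source has the form $f(x_1,\dots,x_{ar(f)})$ with $f$ a function symbol and $x_1,\dots,x_{ar(f)}$ distinct variables. A rule is decent if (no lookahead) the variables in right-hand sides of its positive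 premises do not occur in left-hand sides of its premises, and (no free variables) every variable occurring in the rule occurs in its source or in the right-hand side of a positive premise. A TSS is in decent ntyft format if all its rules are decent ntyft rules. An irredundant proof of $\frac{H}{\alpha}$ from $P=(\Sigma,R)$ is a well-founded, upwardly branching tree with nodes labelled by $\Sigma$-literals, some of whose leaves are marked as hypotheses, such that the root is labelled $\alpha$, $H$ is the set of labels of the hypotheses, and if $\beta$ is the label of a node that is not a hypothesis and $K$ is the set of labels of the nodes directly above it, then $\frac{K}{\beta}$ is a substitution instance of a rule in $R$ (substituting terms over $\Sigma$). Write $P\vdash\frac{N}{\alpha}$ if there is an irredundant proof of $\frac{H}{\alpha}$ from $P$ for some $H\subseteq N$. A well-supported proof of a closed literal $\alpha$ from a standard TSS $P=(\Sigma,R)$ is a well-founded, upwardly branching tree with nodes labelled by closed $\Sigma$-literals, such that the root is labelled $\alpha$, and if $\beta$ is the label of a node and $K$ is the set of labels of the nodes directly above it, then either $\frac{K}{\beta}$ is a closed substitution instance of a rule in $R$, or $\beta$ is negative and for every set $N$ of negative closed $\Sigma$-literals such that $P\vdash\frac{N}{\gamma}$ for some closed $\Sigma$-literal $\gamma$ denying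 $\beta$, a literal in $K$ denies one in $N$. Write $P\vdash_{ws}\alpha$ if such a proof exists. **Theorem.** Let $P_1=(\Sigma_1,R_1)$ and $P_2=(\Sigma_2,R_2)$ be standard TSSs in decent ntyft format (possibly incomplete, i.e. it is not assumed that for every closed literal $t\not\xrightarrow{a}$ either it or some $t\xrightarrow{a}t'$ is $ws$-provable) with $\Sigma_1\subseteq\Sigma_2$ and $R_1\subseteq R_2$, such that each rule in $R_2\setminus R_1$ has a function symbol $f\in\Sigma_2\setminus\Sigma_1$ in its source. Then $P_2$ is a conservative extension of $P_1$: for every closed $\Sigma_2$-literal $\alpha$ whose left-hand side is a term over $\Sigma_1$, $$P_2\vdash_{ws}\alpha\iff P_1\vdash_{ws}\alpha .$$ -/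

import Mathlib

universe u v w x

namespace SOS

/-! Terms are Mathlib's first-order terms `L.Term V`, where `L.Functions n` is the stock of all
`n`-ary function symbols (the relation symbols of `L` play no role) and `V` is the set of variables.
A signature is a set of function symbols; the arity of a symbol is part of the symbol, so that
inclusion of sets is inclusion of signatures. -/

/-- A signature: a collection of function symbols with their arities. -/
abbrev Signature (L : FirstOrder.Language.{u, v}) : Type u := Set (Σ n : ℕ, L.Functions n)

open Classical in
/-- The set of variables occurring in a term. -/
noncomputable def termVars {L : FirstOrder.Language.{u, v}} {V : Type w} (t : L.Term V) : Set V :=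
  {y | y ∈ t.varFinset}

/-- The set of function symbols occurring in a term. -/
def termSymbols {L : FirstOrder.Language.{u, v}} {V : Type w} : L.Term V → Signature L
  | .var _ => ∅
  | .func f ts => {⟨_, f⟩} ∪ ⋃ i, termSymbols (ts i)

/-- `t` is a term over the signature `S`. -/
def TermOver {L : FirstOrder.Language.{u, v}} {V : Type w} (S : Signature L) (t : L.Term V) : Prop :=
  termSymbols t ⊆ S

/-- `t` is a closed term. -/
def TermClosed {L : FirstOrder.Language.{u, v}} {V : Type w} (t : L.Term V) : Prop :=
  termVars t = ∅

/-- Literals: `pos t a t'` is the positive literal `t →ᵃ t'` and `neg t a` is the negative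
literal `t ↛ᵃ`. -/
inductive Literal (L : FirstOrder.Language.{u, v}) (V : Type w) (A : Type x) : Type (max u w x)
  | pos : L.Term V → A → L.Term V → Literal L V A
  | neg : L.Term V → A → Literal L V A

namespace Literal

variable {L : FirstOrder.Language.{u, v}} {V : Type w} {A : Type x}

/-- The left-hand side of a literal. -/
def lhs : Literal L V A → L.Term V
  | pos t _ _ => t
  | neg t _ => t

/-- The set of variables occurring in a literal. -/
noncomputable def vars : Literal L V A → Set V
  | pos t _ t' => termVars t ∪ termVars t'
  | neg t _ => termVars t

/-- The literal is a literal over the signature `S`. -/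
def Over (S : Signature L) : Literal L V A → Prop
  | pos t _ t' => TermOver S t ∧ TermOver S t'
  | neg t _ => TermOver S t

/-- The literal is closed. -/
def Closed (α : Literal L V A) : Prop := α.vars = ∅

/-- The literal is positive. -/
def IsPos : Literal L V A → Prop
  | pos _ _ _ => True
  | neg _ _ => False

/-- The literal is negative. -/
def IsNeg : Literal L V A → Prop
  | pos _ _ _ => False
  | neg _ _ => True

/-- The literals `t →ᵃ t'` and `t ↛ᵃ` deny each other. -/
def Denies : Literal L V A → Literal L V A → Prop
  | pos t a _, neg s b => t = s ∧ a = b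
  | neg t a, pos s b _ => t = s ∧ a = b
  | _, _ => False

/-- Applying a substitution to a literal. -/
def subst (σ : V → L.Term V) : Literal L V A → Literal L V A
  | pos t a t' => pos (t.subst σ) a (t'.subst σ)
  | neg t a => neg (t.subst σ) a

end Literal

/-- A transition rule: a set of premises and a conclusion. -/
structure Rule (L : FirstOrder.Language.{u, v}) (V : Type w) (A : Type x) where
  premises : Set (Literal L V A)
  conclusion : Literal L V A

namespace Rule

variable {L : FirstOrder.Language.{u, v}} {V : Type w} {A : Type x}

/-- The source of a rule: the left-hand side of its conclusion. -/
def source (r : Rule L V A) : L.Term V := r.conclusion.lhs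

/-- The rule is a rule over the signature `S`. -/
def Over (S : Signature L) (r : Rule L V A) : Prop :=
  r.conclusion.Over S ∧ ∀ β ∈ r.premises, β.Over S

/-- The variables occurring in a rule. -/
def vars (r : Rule L V A) : Set V :=
  {y | y ∈ r.conclusion.vars ∨ ∃ β ∈ r.premises, y ∈ β.vars}

/-- The variables occurring in the right-hand sides of the positive premises of a rule. -/
def rhsVars (r : Rule L V A) : Set V :=
  {y | ∃ t a t', Literal.pos t a t' ∈ r.premises ∧ y ∈ termVars t'}

/-- An ntytt rule: the right-hand sides of positive premises are variables that are all distinct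
(different positive premises have different right-hand sides), and that do not occur in the
source. -/
def IsNtytt (r : Rule L V A) : Prop :=
  (∀ t a t', Literal.pos t a t' ∈ r.premises →
    ∃ y : V, t' = FirstOrder.Language.Term.var y ∧ y ∉ termVars r.source) ∧
  (∀ t a s b t', Literal.pos t a t' ∈ r.premises → Literal.pos s b t' ∈ r.premises →
    t = s ∧ a = b)

/-- An ntyft rule: an ntytt rule whose source contains exactly one function symbol and no multiple
occurrences of variables, that is, whose source is `f(x₁, …, xₙ)` with distinct variables `xᵢ`. -/
def IsNtyft (r : Rule L V A) : Prop :=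
  r.IsNtytt ∧ ∃ (n : ℕ) (f : L.Functions n) (y : Fin n → V),
    Function.Injective y ∧ r.source = FirstOrder.Language.Term.func f (fun i => FirstOrder.Language.Term.var (y i))

/-- The rule has no lookahead: the variables in right-hand sides of its positive premises do not
occur in left-hand sides of its premises. -/
def NoLookahead (r : Rule L V A) : Prop :=
  ∀ y ∈ r.rhsVars, ∀ β ∈ r.premises, y ∉ termVars β.lhs

/-- A free variable of a rule: it occurs in the rule, but neither in the source nor in the
right-hand side of a positive premise. -/
def IsFreeVar (r : Rule L V A) (y : V) : Prop :=
  y ∈ r.vars ∧ y ∉ termVars r.source ∧ y ∉ r.rhsVars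

/-- A decent rule: no lookahead and no free variables. -/
def IsDecent (r : Rule L V A) : Prop :=
  r.NoLookahead ∧ ∀ y, ¬ r.IsFreeVar y

end Rule

/-- A transition system specification: a signature and a collection of rules over it. -/
structure TSS (L : FirstOrder.Language.{u, v}) (V : Type w) (A : Type x) where
  sig : Signature L
  rules : Set (Rule L V A)
  rules_over : ∀ r ∈ rules, r.Over sig

/-- Well-founded, upwardly branching trees with nodes labelled by elements of `X`, in which some of
the leaves are marked as hypotheses. -/
inductive ProofTree (X : Type u) : Type (u + 1)
  | hyp (label : X) : ProofTree X
  | node (label : X) (ι : Type u) (above : ι → ProofTree X) : ProofTree X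

namespace ProofTree

variable {X : Type u}

/-- The label of the root. -/
def root : ProofTree X → X
  | hyp l => l
  | node l _ _ => l

/-- The set of labels of the hypotheses. -/
def hyps : ProofTree X → Set X
  | hyp l => {l}
  | node _ _ above => ⋃ i, (above i).hyps

end ProofTree

namespace TSS

variable {L : FirstOrder.Language.{u, v}} {V : Type w} {A : Type x}

/-- A TSS is standard if all its rules have positive conclusions. -/
def IsStandard (P : TSS L V A) : Prop := ∀ r ∈ P.rules, r.conclusion.IsPos

/-- A TSS is in decent ntyft format if it contains decent ntyft rules only. -/
def IsDecentNtyft (P : TSS L V A) : Prop := ∀ r ∈ P.rules, r.IsDecent ∧ r.IsNtyft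

/-- `K / β` is a substitution instance of a rule of `P`. A substitution may be a partial function
from variables to terms over the signature that leaves the variables outside its domain unchanged;
it is extended here by the identity. -/
def IsInstance (P : TSS L V A) (K : Set (Literal L V A)) (β : Literal L V A) : Prop :=
  ∃ r ∈ P.rules, ∃ σ : V → L.Term V, (∀ y, TermOver P.sig (σ y)) ∧
    K = Literal.subst σ '' r.premises ∧ β = r.conclusion.subst σ

/-- `K / β` is a closed substitution instance of a rule of `P`, obtained from a total function from
variables to closed terms over the signature. -/
def IsClosedInstance (P : TSS L V A) (K : Set (Literal L V A)) (β : Literal L V A) : Prop :=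
  ∃ r ∈ P.rules, ∃ σ : V → L.Term V, (∀ y, TermOver P.sig (σ y) ∧ TermClosed (σ y)) ∧
    K = Literal.subst σ '' r.premises ∧ β = r.conclusion.subst σ

/-- The tree `π` is an irredundant proof from `P` (of the rule `π.hyps / π.root`). -/
def IsProof (P : TSS L V A) : ProofTree (Literal L V A) → Prop
  | .hyp β => β.Over P.sig
  | .node β _ above =>
      β.Over P.sig ∧ P.IsInstance (Set.range fun i => (above i).root) β ∧
        ∀ i, P.IsProof (above i)

/-- `P ⊢_irr H / α`. -/
def IrrProvable (P : TSS L V A) (H : Set (Literal L V A)) (α : Literal L V A) : Prop :=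
  ∃ π, P.IsProof π ∧ π.root = α ∧ π.hyps = H

/-- `P ⊢ K / α`. -/
def Provable (P : TSS L V A) (K : Set (Literal L V A)) (α : Literal L V A) : Prop :=
  ∃ H ⊆ K, P.IrrProvable H α

/-- Negation as failure: `β` is negative and for every set `N` of negative closed literals such
that `P ⊢ N / γ` for a closed literal `γ` denying `β`, a literal in `K` denies one in `N`. -/
def Refutes (P : TSS L V A) (K : Set (Literal L V A)) (β : Literal L V A) : Prop :=
  β.IsNeg ∧
    ∀ N : Set (Literal L V A), (∀ ν ∈ N, ν.IsNeg ∧ ν.Closed ∧ ν.Over P.sig) →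
      ∀ γ : Literal L V A, γ.Closed → γ.Over P.sig → γ.Denies β → P.Provable N γ →
        ∃ κ ∈ K, ∃ ν ∈ N, κ.Denies ν

/-- The tree `π` is a well-supported proof (of `π.root`) from `P`; it has no leaves marked as
hypotheses. -/
def IsWellSupportedProof (P : TSS L V A) : ProofTree (Literal L V A) → Prop
  | .hyp _ => False
  | .node β _ above =>
      (β.Closed ∧ β.Over P.sig) ∧
        (P.IsClosedInstance (Set.range fun i => (above i).root) β ∨
          P.Refutes (Set.range fun i => (above i).root) β) ∧
        ∀ i, P.IsWellSupportedProof (above i)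

/-- `P ⊢_ws α`. -/
def WSProvable (P : TSS L V A) (α : Literal L V A) : Prop :=
  ∃ π, P.IsWellSupportedProof π ∧ π.root = α

/-- `P₂` is a conservative extension of `P₁`: the same closed literals over the signature of `P₂`
with a left-hand side over the signature of `P₁` are ws-provable from both. -/
def IsConservativeExtension (P₂ P₁ : TSS L V A) : Prop :=
  ∀ α : Literal L V A, α.Closed → α.Over P₂.sig → TermOver P₁.sig α.lhs →
    (P₂.WSProvable α ↔ P₁.WSProvable α)

end TSS

end SOS

namespace SOS

/-! ### Variables and symbols of terms, literals and rules under substitution. -/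

section Terms

variable {L : FirstOrder.Language.{u, v}} {V : Type w} {A : Type x}

/-! Read a proof from its root upwards and suppose the left-hand side there is over the old
signature. The rule applied is then old, since a new rule would put a new symbol there. By decency
the variables in left-hand sides of premises come from the source, so the literals directly above
have old left-hand sides too. By induction those literals are entirely old, right-hand sides
included; as there are no free variables, every variable of the rule is sent to an old term, and so
the whole conclusion is old. This gives `IsProof.restrict` for proofs from negative hypotheses.

Negation as failure then transfers both ways. From old to new, the extension has no further ways to
deny an old negative literal, so the same tree still works (`IsWellSupportedProof.extend`). From new
to old, denials over the original TSS persist in the extension, and among the literals refuting them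
only those with an old left-hand side matter (`IsWellSupportedProof.restrict`). -/

theorem mem_termVars_var {y z : V} :
    y ∈ termVars (FirstOrder.Language.Term.var z : L.Term V) ↔ y = z := by
  simp [termVars, FirstOrder.Language.Term.varFinset]

theorem mem_termVars_func {y : V} {n : ℕ} {f : L.Functions n} {ts : Fin n → L.Term V} :
    y ∈ termVars (FirstOrder.Language.Term.func f ts) ↔ ∃ i, y ∈ termVars (ts i) := by
  simp [termVars, FirstOrder.Language.Term.varFinset]

theorem termOver_func {S : Signature L} {n : ℕ} {f : L.Functions n} {ts : Fin n → L.Term V} :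
    TermOver S (FirstOrder.Language.Term.func f ts) ↔ ⟨n, f⟩ ∈ S ∧ ∀ i, TermOver S (ts i) := by
  simp [TermOver, termSymbols, Set.insert_subset_iff]

theorem termOver_var (S : Signature L) (y : V) :
    TermOver S (FirstOrder.Language.Term.var y : L.Term V) := by
  simp [TermOver, termSymbols]

theorem termOver_subst {S : Signature L} {σ : V → L.Term V} {t : L.Term V} :
    TermOver S (t.subst σ) ↔ TermOver S t ∧ ∀ y ∈ termVars t, TermOver S (σ y) := by
  induction t with
  | var z => simp [FirstOrder.Language.Term.subst, termOver_var, mem_termVars_var]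
  | func f ts ih =>
    simp only [FirstOrder.Language.Term.subst, termOver_func, mem_termVars_func, ih]
    grind

theorem term_subst_congr {σ τ : V → L.Term V} {t : L.Term V}
    (h : ∀ y ∈ termVars t, σ y = τ y) : t.subst σ = t.subst τ := by
  induction t with
  | var z => exact h z (mem_termVars_var.2 rfl)
  | func f ts ih =>
    simp only [FirstOrder.Language.Term.subst]
    congr 1
    exact funext fun i => ih i fun y hy => h y (mem_termVars_func.2 ⟨i, hy⟩)

namespace Literal

theorem lhs_subst (σ : V → L.Term V) (β : Literal L V A) :
    (β.subst σ).lhs = β.lhs.subst σ := by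
  cases β <;> rfl

theorem subst_congr {σ τ : V → L.Term V} {β : Literal L V A}
    (h : ∀ y ∈ β.vars, σ y = τ y) : β.subst σ = β.subst τ := by
  cases β with
  | pos t a t' =>
    simp only [subst, term_subst_congr fun y hy => h y (Or.inl hy),
      term_subst_congr fun y hy => h y (Or.inr hy)]
  | neg t a => simp only [subst, term_subst_congr h]

theorem termVars_lhs_subset (β : Literal L V A) : termVars β.lhs ⊆ β.vars := by
  cases β with
  | pos t a t' => exact Set.subset_union_left
  | neg t a => exact subset_rfl

theorem Over.lhs {S : Signature L} {β : Literal L V A} (h : β.Over S) : TermOver S β.lhs := by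
  cases β with
  | pos t a t' => exact h.1
  | neg t a => exact h

theorem Over.mono {S T : Signature L} (hST : S ⊆ T) {β : Literal L V A} (h : β.Over S) :
    β.Over T := by
  cases β with
  | pos t a t' => exact ⟨h.1.trans hST, h.2.trans hST⟩
  | neg t a => exact Set.Subset.trans h hST

/-- A negative literal has no right-hand side in which a new symbol could hide. This is why
hypotheses are required to be negative in `IsProof.restrict`. -/
theorem IsNeg.over {S : Signature L} {β : Literal L V A} (hβ : β.IsNeg)
    (h : TermOver S β.lhs) : β.Over S := by
  cases β with
  | pos t a t' => exact hβ.elim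
  | neg t a => exact h

theorem Denies.lhs_eq {β γ : Literal L V A} (h : β.Denies γ) : β.lhs = γ.lhs := by
  cases β <;> cases γ <;> first | exact h.1 | exact h.elim

theorem over_subst {S : Signature L} {σ : V → L.Term V} {β : Literal L V A}
    (hβ : β.Over S) (h : ∀ y ∈ β.vars, TermOver S (σ y)) : (β.subst σ).Over S := by
  cases β with
  | pos t a t' =>
    exact ⟨termOver_subst.2 ⟨hβ.1, fun y hy => h y (Or.inl hy)⟩,
      termOver_subst.2 ⟨hβ.2, fun y hy => h y (Or.inr hy)⟩⟩
  | neg t a => exact termOver_subst.2 ⟨hβ, h⟩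

end Literal

namespace Rule

theorem conclusion_vars_subset (r : Rule L V A) : r.conclusion.vars ⊆ r.vars :=
  fun _ hy => Or.inl hy

theorem premise_vars_subset {r : Rule L V A} {β : Literal L V A} (hβ : β ∈ r.premises) :
    β.vars ⊆ r.vars :=
  fun _ hy => Or.inr ⟨β, hβ, hy⟩

/-- In a decent rule the variables in the left-hand sides of the premises come from the source. -/
theorem IsDecent.premise_lhs_vars {r : Rule L V A} (hr : r.IsDecent) {β : Literal L V A}
    (hβ : β ∈ r.premises) : termVars β.lhs ⊆ termVars r.source := by
  intro y hy
  by_contra hsrc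
  exact hr.2 y ⟨premise_vars_subset hβ (β.termVars_lhs_subset hy), hsrc,
    fun hrhs => hr.1 y hrhs β hβ hy⟩

/-- If the instance of the source is over `S`, so are the left-hand sides of the premises. -/
theorem IsDecent.premise_lhs_over {S : Signature L} {r : Rule L V A} (hr : r.IsDecent)
    (hover : r.Over S) {σ : V → L.Term V} (hsrc : TermOver S (r.source.subst σ))
    {β : Literal L V A} (hβ : β ∈ r.premises) : TermOver S (β.subst σ).lhs := by
  rw [Literal.lhs_subst]
  exact termOver_subst.2 ⟨(hover.2 β hβ).lhs, fun y hy =>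
    (termOver_subst.1 hsrc).2 y (hr.premise_lhs_vars hβ hy)⟩

/-- If the instances of the source and of the premises are over `S`, then the substitution takes
all variables of a decent rule to terms over `S`. -/
theorem IsDecent.subst_over {S : Signature L} {r : Rule L V A} (hr : r.IsDecent)
    {σ : V → L.Term V} (hsrc : TermOver S (r.source.subst σ))
    (hprem : ∀ β ∈ r.premises, (β.subst σ).Over S) {y : V} (hy : y ∈ r.vars) :
    TermOver S (σ y) := by
  by_cases hys : y ∈ termVars r.source
  · exact (termOver_subst.1 hsrc).2 y hys
  · by_cases hyr : y ∈ r.rhsVars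
    · obtain ⟨t, a, t', hmem, hyt⟩ := hyr
      exact (termOver_subst.1 (hprem _ hmem).2).2 y hyt
    · exact (hr.2 y ⟨hy, hys, hyr⟩).elim

/-- An instance of a rule is not affected by changing the substitution outside its variables. -/
theorem subst_congr {r : Rule L V A} {σ τ : V → L.Term V} (h : ∀ y ∈ r.vars, σ y = τ y) :
    Literal.subst σ '' r.premises = Literal.subst τ '' r.premises ∧
      r.conclusion.subst σ = r.conclusion.subst τ :=
  ⟨Set.image_congr fun _ hβ =>
      Literal.subst_congr fun y hy => h y (premise_vars_subset hβ hy),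
    Literal.subst_congr fun y hy => h y (r.conclusion_vars_subset hy)⟩

end Rule

end Terms

namespace TSS

variable {L : FirstOrder.Language.{u, v}} {V : Type w} {A : Type x} {P₁ P₂ : TSS L V A}

/-! ### Monotonicity of provability, and assembling well-supported proofs. -/

theorem IsInstance.mono (hsig : P₁.sig ⊆ P₂.sig) (hrules : P₁.rules ⊆ P₂.rules)
    {K : Set (Literal L V A)} {β : Literal L V A} (h : P₁.IsInstance K β) :
    P₂.IsInstance K β := by
  obtain ⟨r, hr, σ, hσ, hK, hβ⟩ := h
  exact ⟨r, hrules hr, σ, fun y => (hσ y).trans hsig, hK, hβ⟩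

theorem IsClosedInstance.mono (hsig : P₁.sig ⊆ P₂.sig) (hrules : P₁.rules ⊆ P₂.rules)
    {K : Set (Literal L V A)} {β : Literal L V A} (h : P₁.IsClosedInstance K β) :
    P₂.IsClosedInstance K β := by
  obtain ⟨r, hr, σ, hσ, hK, hβ⟩ := h
  exact ⟨r, hrules hr, σ, fun y => ⟨(hσ y).1.trans hsig, (hσ y).2⟩, hK, hβ⟩

theorem IsProof.mono (hsig : P₁.sig ⊆ P₂.sig) (hrules : P₁.rules ⊆ P₂.rules)
    {π : ProofTree (Literal L V A)} (h : P₁.IsProof π) : P₂.IsProof π := by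
  induction π with
  | hyp β => exact Literal.Over.mono hsig h
  | node β ι above ih =>
    exact ⟨h.1.mono hsig, h.2.1.mono hsig hrules, fun i => ih i (h.2.2 i)⟩

theorem Provable.mono (hsig : P₁.sig ⊆ P₂.sig) (hrules : P₁.rules ⊆ P₂.rules)
    {N : Set (Literal L V A)} {β : Literal L V A} (h : P₁.Provable N β) : P₂.Provable N β := by
  obtain ⟨H, hH, π, hπ, hroot, hhyps⟩ := h
  exact ⟨H, hH, π, hπ.mono hsig hrules, hroot, hhyps⟩

/-- A family of ws-provable literals may be used above a new root. -/
theorem WSProvable.of_range {β : Literal L V A} {ι : Type (max u w x)}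
    {κ : ι → Literal L V A} (hβ : β.Closed ∧ β.Over P₁.sig)
    (h : P₁.IsClosedInstance (Set.range κ) β ∨ P₁.Refutes (Set.range κ) β)
    (hκ : ∀ i, P₁.WSProvable (κ i)) : P₁.WSProvable β := by
  choose π hπ hroot using hκ
  obtain rfl : (fun i => (π i).root) = κ := funext hroot
  exact ⟨.node β ι π, ⟨hβ, h, hπ⟩, rfl⟩

/-! ### Restricting irredundant proofs to the original TSS. -/

/-- A rule of the extension with an instance whose source is over the original signature is a rule
of the original TSS. -/
theorem mem_rules_of_source_over
    (hnew : ∀ r ∈ P₂.rules \ P₁.rules, ∃ f ∈ P₂.sig \ P₁.sig, f ∈ termSymbols r.source)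
    {r : Rule L V A} (hr : r ∈ P₂.rules) {σ : V → L.Term V}
    (hsrc : TermOver P₁.sig (r.source.subst σ)) : r ∈ P₁.rules := by
  by_contra hr₁
  obtain ⟨f, hf, hfr⟩ := hnew r ⟨hr, hr₁⟩
  exact hf.2 ((termOver_subst.1 hsrc).1 hfr)

/-- Irredundant proofs from the extension with negative hypotheses, whose conclusion has a
left-hand side over the original signature, are proofs from the original TSS. -/
theorem IsProof.restrict (hfmt : P₂.IsDecentNtyft)
    (hnew : ∀ r ∈ P₂.rules \ P₁.rules, ∃ f ∈ P₂.sig \ P₁.sig, f ∈ termSymbols r.source)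
    {π : ProofTree (Literal L V A)} (h : P₂.IsProof π) (hneg : ∀ ν ∈ π.hyps, ν.IsNeg)
    (hlhs : TermOver P₁.sig π.root.lhs) :
    P₁.IsProof π ∧ π.root.Over P₁.sig ∧ ∀ ν ∈ π.hyps, ν.Over P₁.sig := by
  classical
  induction π with
  | hyp β =>
    have hβ : β.Over P₁.sig := (hneg β rfl).over hlhs
    exact ⟨hβ, hβ, fun ν hν => by obtain rfl : ν = β := hν; exact hβ⟩
  | node β ι above ih =>
    obtain ⟨-, ⟨r, hr, σ, -, hK, rfl⟩, habove⟩ := h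
    have hsrc : TermOver P₁.sig (r.source.subst σ) :=
      Literal.lhs_subst σ r.conclusion ▸ hlhs
    have hr₁ := mem_rules_of_source_over hnew hr hsrc
    have hdec := (hfmt r hr).1
    have hover := P₁.rules_over r hr₁
    have key : ∀ i, P₁.IsProof (above i) ∧ (above i).root.Over P₁.sig ∧
        ∀ ν ∈ (above i).hyps, ν.Over P₁.sig := by
      intro i
      refine ih i (habove i) (fun ν hν => hneg ν (Set.mem_iUnion.2 ⟨i, hν⟩)) ?_
      obtain ⟨γ, hγ, (hγi : _ = (above i).root)⟩ := hK.subset ⟨i, rfl⟩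
      rw [← hγi]
      exact hdec.premise_lhs_over hover hsrc hγ
    -- The part of the induction hypothesis about whole literals is needed here: it controls the
    -- targets of positive premises, hence the variables not in the source.
    have hσ : ∀ y ∈ r.vars, TermOver P₁.sig (σ y) := fun y hy => by
      refine hdec.subst_over hsrc (fun γ hγ => ?_) hy
      obtain ⟨i, hi⟩ := hK.superset ⟨γ, hγ, rfl⟩
      rw [← hi]
      exact (key i).2.1
    have hroot : (r.conclusion.subst σ).Over P₁.sig :=
      Literal.over_subst hover.1 fun y hy => hσ y (r.conclusion_vars_subset hy)
    -- Off the variables of the rule, `σ` may take values with new symbols; there it is replaced by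
    -- the identity.
    refine ⟨⟨hroot, ⟨r, hr₁,
      fun y => if y ∈ r.vars then σ y else .var y, fun y => ?_, ?_⟩, fun i => (key i).1⟩, hroot,
      fun ν hν => ?_⟩
    · dsimp only
      split_ifs with hy
      exacts [hσ y hy, termOver_var _ y]
    · rw [hK]
      exact Rule.subst_congr fun y hy => by simp [hy]
    · obtain ⟨i, hi⟩ := Set.mem_iUnion.1 hν
      exact (key i).2.2 ν hi

/-! ### Transfer of well-supported proofs in both directions. -/

/-- Well-supported proofs from the original TSS are well-supported proofs from the extension. -/
theorem IsWellSupportedProof.extend (hfmt : P₂.IsDecentNtyft)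
    (hsig : P₁.sig ⊆ P₂.sig) (hrules : P₁.rules ⊆ P₂.rules)
    (hnew : ∀ r ∈ P₂.rules \ P₁.rules, ∃ f ∈ P₂.sig \ P₁.sig, f ∈ termSymbols r.source)
    {π : ProofTree (Literal L V A)} (h : P₁.IsWellSupportedProof π) :
    P₂.IsWellSupportedProof π := by
  induction π with
  | hyp β => exact h
  | node β ι above ih =>
    obtain ⟨⟨hcl, hβ⟩, hstep, habove⟩ := h
    refine ⟨⟨hcl, hβ.mono hsig⟩, hstep.imp (fun hi => hi.mono hsig hrules) ?_,
      fun i => ih i (habove i)⟩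
    rintro ⟨hneg, href⟩
    refine ⟨hneg, fun N hN γ hγ _ hden ⟨H, hHN, π, hπ, hroot, hhyps⟩ => ?_⟩
    subst hroot hhyps
    obtain ⟨hπ₁, hγ₁, hH₁⟩ := hπ.restrict hfmt hnew (fun ν hν => (hN ν (hHN hν)).1)
      (hden.lhs_eq ▸ hβ.lhs)
    obtain ⟨κ, hκ, ν, hν, hκν⟩ := href π.hyps
      (fun ν hν => ⟨(hN ν (hHN hν)).1, (hN ν (hHN hν)).2.1, hH₁ ν hν⟩) π.root hγ hγ₁ hden
      ⟨π.hyps, subset_rfl, π, hπ₁, rfl, rfl⟩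
    exact ⟨κ, hκ, ν, hHN hν, hκν⟩

/-- The conclusion of a well-supported proof from the extension is ws-provable from the original
TSS when its left-hand side is over the original signature. -/
theorem IsWellSupportedProof.restrict (hfmt : P₂.IsDecentNtyft)
    (hsig : P₁.sig ⊆ P₂.sig) (hrules : P₁.rules ⊆ P₂.rules)
    (hnew : ∀ r ∈ P₂.rules \ P₁.rules, ∃ f ∈ P₂.sig \ P₁.sig, f ∈ termSymbols r.source)
    {π : ProofTree (Literal L V A)} (h : P₂.IsWellSupportedProof π)
    (hlhs : TermOver P₁.sig π.root.lhs) :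
    π.root.Over P₁.sig ∧ P₁.WSProvable π.root := by
  classical
  induction π with
  | hyp β => exact h.elim
  | node β ι above ih =>
    obtain ⟨⟨hcl, -⟩, hstep, habove⟩ := h
    rcases hstep with ⟨r, hr, σ, hσcl, hK, rfl⟩ | ⟨hneg, href⟩
    · have hsrc : TermOver P₁.sig (r.source.subst σ) :=
        Literal.lhs_subst σ r.conclusion ▸ hlhs
      have hr₁ := mem_rules_of_source_over hnew hr hsrc
      have hdec := (hfmt r hr).1
      have hover := P₁.rules_over r hr₁
      have key : ∀ i, (above i).root.Over P₁.sig ∧ P₁.WSProvable (above i).root := by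
        intro i
        refine ih i (habove i) ?_
        obtain ⟨γ, hγ, (hγi : _ = (above i).root)⟩ := hK.subset ⟨i, rfl⟩
        rw [← hγi]
        exact hdec.premise_lhs_over hover hsrc hγ
      have hσ : ∀ y ∈ r.vars, TermOver P₁.sig (σ y) := fun y hy => by
        refine hdec.subst_over hsrc (fun γ hγ => ?_) hy
        obtain ⟨i, hi⟩ := hK.superset ⟨γ, hγ, rfl⟩
        rw [← hi]
        exact (key i).1
      have hroot : (r.conclusion.subst σ).Over P₁.sig :=
        Literal.over_subst hover.1 fun y hy => hσ y (r.conclusion_vars_subset hy)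
      -- The default value must now be a closed old term; the left-hand side of the conclusion is
      -- one at hand.
      refine ⟨hroot, WSProvable.of_range ⟨hcl, hroot⟩ (Or.inl ⟨r, hr₁,
        fun y => if y ∈ r.vars then σ y else (r.conclusion.subst σ).lhs, fun y => ?_, ?_⟩)
        fun i => (key i).2⟩
      · dsimp only
        split_ifs with hy
        · exact ⟨hσ y hy, (hσcl y).2⟩
        · exact ⟨hroot.lhs, Set.subset_empty_iff.1
            ((Literal.termVars_lhs_subset _).trans (Set.subset_empty_iff.2 hcl))⟩
      · rw [hK]
        exact Rule.subst_congr fun y hy => by simp [hy]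
    · have hβ : β.Over P₁.sig := hneg.over hlhs
      -- Subtrees whose root has a left-hand side with new symbols are discarded: the induction
      -- hypothesis says nothing about them.
      refine ⟨hβ, WSProvable.of_range
        (κ := fun i : {i : ι // TermOver P₁.sig (above i).root.lhs} => (above i).root)
        ⟨hcl, hβ⟩ (Or.inr ⟨hneg, fun N hN γ hγ hγ₁ hden hprov => ?_⟩)
        fun i => (ih i (habove i) i.2).2⟩
      obtain ⟨_, ⟨i, rfl⟩, ν, hν, hκν⟩ := href N
        (fun ν hν => ⟨(hN ν hν).1, (hN ν hν).2.1, (hN ν hν).2.2.mono hsig⟩) γ hγ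
        (hγ₁.mono hsig) hden (hprov.mono hsig hrules)
      refine ⟨(above i).root, ⟨⟨i, ?_⟩, rfl⟩, ν, hν, hκν⟩
      -- The refuting literal survives the discarding, as it shares its left-hand side with the old
      -- literal it denies.
      have hνlhs := (hN ν hν).2.2.lhs
      rwa [← hκν.lhs_eq] at hνlhs

end TSS

end SOS

theorem mainTheorem8 {L : FirstOrder.Language.{u, v}} {V : Type w} {A : Type x}
    (P₁ P₂ : SOS.TSS L V A)
    (hstd₁ : P₁.IsStandard) (hstd₂ : P₂.IsStandard)
    (hfmt₁ : P₁.IsDecentNtyft) (hfmt₂ : P₂.IsDecentNtyft)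
    (hsig : P₁.sig ⊆ P₂.sig) (hrules : P₁.rules ⊆ P₂.rules)
    (hnew : ∀ r ∈ P₂.rules \ P₁.rules,
      ∃ f ∈ P₂.sig \ P₁.sig, f ∈ SOS.termSymbols r.source) :
    P₂.IsConservativeExtension P₁ := by
  intro α _ _ hlhs
  constructor
  · rintro ⟨π, hπ, rfl⟩
    exact (hπ.restrict hfmt₂ hsig hrules hnew hlhs).2
  · rintro ⟨π, hπ, rfl⟩
    exact ⟨π, hπ.extend hfmt₂ hsig hrules hnew, rfl⟩
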